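/- Let $\rho>1$. For a complex Hilbert space $H$, let $C_\rho(H)$ be the set of bounded operators $T$ on $H$ that admit a unitary $\rho$-dilation, i.e. there are a Hilbert space $\mathcal H\supseteq H$ and a unitary operator $U$ on $\mathcal H$ with $T^k=\rho\,P_HU^k|_H$ for all $k\ge 1$, where $P_H$ is the orthogonal projection onto $H$; put $w_\rho(T)=\inf\{\gamma>0:\gamma^{-1}T\in C_\rho(H)\}$. For $T_0,T_1\in C_\rho(H)$, say that $T_1$ is Harnack dominated by $T_0$ if there is a constant $c\ge 1$ such that $$\operatorname{Re}p(T_1)\le c^2\operatorname{Re}p(T_0)+(c^2-1)(\rho-1)\operatorname{Re}p(0_H)$$ for every complex polynomial $p$ with $\operatorname{Re}p\ge 0$ on the closed unit disc, where $\operatorname{Re}A=\frac12(A+A^*)$. The Harnack part of $T\in C_\rho(H)$ is the set of all $T'\in C_\rho(H)$ such that $T'$ and $T$ are Harnack dominated by each other. Let $n+1\ge 2$ be even, let $S_{n+1}(b)$ be the $(n+1)\times(n+1)$ matrix with all superdiagonal entries equal to $b$ and all other entries $0$, acting on the Hilbert space $\mathbb C^{n+1}$, and let $S=S_{n+1}(a)$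 with $a=w_\rho(S_{n+1}(1))^{-1}$. Then the unitary orbit of $S$ in the Harnack part of $S$ is trivial: $$\{U^*SU : U \text{ unitary on } \mathbb C^{n+1}\}\cap\{T : T \text{ belongs to the Harnack part of } S \text{ in } C_\rho(\mathbb C^{n+1})\}=\{S\}.$$ -/

import Mathlib

noncomputable section

namespace RhoHarnack

universe u

section Hilbert

variable {H : Type u} [NormedAddCommGroup H] [InnerProductSpace ℂ H] [CompleteSpace H]

/-- `T` is a `ρ`-contraction, i.e. `T ∈ C_ρ(H)`: it has a unitary `ρ`-dilation. The inclusion of `H`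
as a closed subspace of the larger Hilbert space `K` is the linear isometry `V`, so the adjoint of
`V` is the orthogonal projection onto `H`, and the compression `P_H U ^ k | H` is `V† U ^ k V`. -/
def IsRhoContraction (ρ : ℝ) (T : H →L[ℂ] H) : Prop :=
  ∃ (K : Type u) (_ : NormedAddCommGroup K) (_ : InnerProductSpace ℂ K) (_ : CompleteSpace K)
    (V : H →ₗᵢ[ℂ] K) (U : K →L[ℂ] K),
    U ∈ unitary (K →L[ℂ] K) ∧
      ∀ k : ℕ, 1 ≤ k →
        T ^ k = (ρ : ℂ) •
          (ContinuousLinearMap.adjoint V.toContinuousLinearMap ∘L (U ^ k) ∘L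
            V.toContinuousLinearMap)

/-- The `ρ`-numerical radius `w_ρ(T) = inf {γ > 0 : γ⁻¹ T ∈ C_ρ(H)}`. -/
def rhoRadius (ρ : ℝ) (T : H →L[ℂ] H) : ℝ :=
  sInf {γ : ℝ | 0 < γ ∧ IsRhoContraction ρ ((γ : ℂ)⁻¹ • T)}

/-- The real part `Re p(T) = (p(T) + p(T)*) / 2` of a polynomial in an operator. -/
def rePoly (p : Polynomial ℂ) (T : H →L[ℂ] H) : H →L[ℂ] H :=
  (realPart (Polynomial.aeval T p) : selfAdjoint (H →L[ℂ] H))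

/-- `T₁` is Harnack dominated by `T₀` in `C_ρ(H)`. The order on operators is the Loewner order. -/
def HarnackDominated (ρ : ℝ) (T₁ T₀ : H →L[ℂ] H) : Prop :=
  IsRhoContraction ρ T₁ ∧ IsRhoContraction ρ T₀ ∧
    ∃ c : ℝ, 1 ≤ c ∧ ∀ p : Polynomial ℂ,
      (∀ z : ℂ, ‖z‖ ≤ 1 → 0 ≤ (p.eval z).re) →
        rePoly p T₁ ≤ ((c ^ 2 : ℝ) : ℂ) • rePoly p T₀
          + (((c ^ 2 - 1) * (ρ - 1) : ℝ) : ℂ) • rePoly p (0 : H →L[ℂ] H)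

/-- The Harnack part of `T` in `C_ρ(H)`: its class for Harnack equivalence. -/
def harnackPart (ρ : ℝ) (T : H →L[ℂ] H) : Set (H →L[ℂ] H) :=
  {T' | HarnackDominated ρ T' T ∧ HarnackDominated ρ T T'}

/-- The unitary orbit `{U* T U : U unitary}` of `T`. -/
def unitaryOrbit (T : H →L[ℂ] H) : Set (H →L[ℂ] H) :=
  {T' | ∃ U ∈ unitary (H →L[ℂ] H), T' = star U * T * U}

end Hilbert

/-- The truncated shift `S_m(b)` on `ℂ^m`: the matrix with `b` on the superdiagonal and `0`
elsewhere. -/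
def truncatedShift (m : ℕ) (b : ℂ) :
    EuclideanSpace ℂ (Fin m) →L[ℂ] EuclideanSpace ℂ (Fin m) :=
  Matrix.toEuclideanCLM (𝕜 := ℂ)
    (Matrix.of fun i j : Fin m => if (i : ℕ) + 1 = (j : ℕ) then b else 0)

/-- The `w_ρ`-normalized truncated shift `S_m(a)` of size `m`, where `a = w_ρ(S_m(1))⁻¹`. -/
def normalizedShift (ρ : ℝ) (m : ℕ) :
    EuclideanSpace ℂ (Fin m) →L[ℂ] EuclideanSpace ℂ (Fin m) :=
  truncatedShift m (((rhoRadius ρ (truncatedShift m 1))⁻¹ : ℝ) : ℂ)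

end RhoHarnack

end

noncomputable section

namespace RhoHarnack

/-! For nilpotent `T`, `rhoForm` is the form `(ρ - 2)‖x‖² + 2 Re ⟨x, (1 - T)⁻¹ x⟩`. Fejér
polynomials turn Harnack domination into `rhoForm (ζT₁) ≤ c² rhoForm (ζT₀)` for `‖ζ‖ ≤ 1`
(`exists_rhoForm_le`), so null vectors for `ζT₀` are null for `ζT₁` once the latter form is
nonnegative. An explicit dilation shows that a truncated shift with real entry is a `ρ`-contraction
exactly when its form is nonnegative; at the critical entry `a` the form is therefore nonnegative
but degenerate (`exists_normalizedShift_eq`). The substitution `x = w - Sw` makes the null equation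
a three-term recurrence, whence the null space is a line. In even dimension its generator `v` has no
zero entry (`exists_null_line`). If `U* S U` is dominated by `S`, then `U` preserves the null line
for each `ζS`, `‖ζ‖ = 1`, that is, the line of `phase η v` for every unimodular `η`. Comparing
polynomials in `η` makes `U` a scalar, so `U* S U = S`. -/

open Finset Filter Topology

/-! ### Fejér sums and the quadratic form of the kernel -/

section General

variable {E : Type*} [NormedAddCommGroup E] [InnerProductSpace ℂ E]

/-- Positivity of the Fejér kernel. The partial sums satisfy `s_{N+1} = x + U s_N`; expanding the
square gives `‖s_{N+1}‖² ≤ 2 Re ⟨x, s_{N+1}⟩ - ‖x‖² + ‖s_N‖²`. It serves both for unitary dilations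
and for scalars. -/
theorem norm_sq_sum_pow_le (U : E →L[ℂ] E) (hU : ∀ x, ‖U x‖ ≤ ‖x‖) (x : E) (N : ℕ) :
    ‖∑ k ∈ range N, (U ^ k) x‖ ^ 2 ≤
      ∑ m ∈ range N, (2 * (inner ℂ x (∑ k ∈ range (m + 1), (U ^ k) x)).re - ‖x‖ ^ 2) := by
  induction N with
  | zero => simp
  | succ N ih =>
    rw [sum_range_succ (fun m => 2 * _ - _)]
    have hs : ∑ k ∈ range (N + 1), (U ^ k) x = x + U (∑ k ∈ range N, (U ^ k) x) := by
      rw [sum_range_succ', map_sum, add_comm]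
      simp [pow_succ']
    rw [hs]
    have h1 := norm_add_sq (𝕜 := ℂ) x (U (∑ k ∈ range N, (U ^ k) x))
    have h2 := pow_le_pow_left₀ (norm_nonneg _) (hU (∑ k ∈ range N, (U ^ k) x)) 2
    have h3 := inner_self_eq_norm_sq (𝕜 := ℂ) x
    simp only [inner_add_right, Complex.add_re] at *
    simp only [RCLike.re_to_complex] at *
    linarith

/-- The quadratic form of the truncated operator kernel
`(∑ k ≤ m, T ^ k) + (∑ k ≤ m, T ^ k)* + (ρ - 2)`. -/
def rhoForm (ρ : ℝ) (m : ℕ) (T : E →L[ℂ] E) (x : E) : ℝ :=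
  (ρ - 2) * ‖x‖ ^ 2 + 2 * (inner ℂ x (∑ k ∈ range (m + 1), (T ^ k) x)).re

theorem rhoForm_of_le (ρ : ℝ) {n m : ℕ} {T : E →L[ℂ] E} (hT : T ^ (n + 1) = 0) (h : n ≤ m)
    (x : E) : rhoForm ρ m T x = rhoForm ρ n T x := by
  obtain ⟨d, rfl⟩ := Nat.exists_eq_add_of_le h
  have : ∑ k ∈ range (n + d + 1), (T ^ k) x = ∑ k ∈ range (n + 1), (T ^ k) x := by
    rw [show n + d + 1 = (n + 1) + d by ring, sum_range_add]
    simp [pow_add, hT]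
  simp only [rhoForm, this]

theorem rhoForm_zero (ρ : ℝ) (m : ℕ) (x : E) : rhoForm ρ m 0 x = ρ * ‖x‖ ^ 2 := by
  rw [rhoForm_of_le ρ (n := 0) (by simp) (Nat.zero_le m)]
  have h := inner_self_eq_norm_sq (𝕜 := ℂ) x
  simp only [RCLike.re_to_complex] at h
  simp only [rhoForm, zero_add, range_one, sum_singleton, pow_zero, one_apply_eq_self, h]
  ring

theorem nonneg_of_sum_nonneg_of_eventually_const {f : ℕ → ℝ} {L : ℝ} {n : ℕ}
    (hf : ∀ m, n ≤ m → f m = L) (hs : ∀ N, 0 ≤ ∑ m ∈ range N, f m) : 0 ≤ L := by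
  have h1 : Tendsto f atTop (𝓝 L) :=
    tendsto_const_nhds.congr' (eventually_atTop.2 ⟨n, fun m hm => (hf m hm).symm⟩)
  exact ge_of_tendsto' h1.cesaro fun N => mul_nonneg (by positivity) (hs N)

/-- `N` times the Fejér polynomial of order `N`, rotated by `ζ`. -/
def fejer (ζ : ℂ) (N : ℕ) : Polynomial ℂ :=
  ∑ m ∈ range N, (2 * ∑ k ∈ range (m + 1), (ζ • (Polynomial.X : Polynomial ℂ)) ^ k - 1)

theorem aeval_fejer (ζ : ℂ) (N : ℕ) (T : E →L[ℂ] E) :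
    Polynomial.aeval T (fejer ζ N) =
      ∑ m ∈ range N, (2 * ∑ k ∈ range (m + 1), (ζ • T) ^ k - 1) := by
  simp [fejer, map_ofNat]

/-- The geometric sum inverts `1 - T`, so in the variable `w` the form involves only `w` and `T w`;
for a shift it becomes tridiagonal. -/
theorem rhoForm_sub_apply (ρ : ℝ) {n : ℕ} {T : E →L[ℂ] E} (hT : T ^ (n + 1) = 0) (w : E) :
    rhoForm ρ n T (w - T w) =
      ρ * ‖w‖ ^ 2 - 2 * (ρ - 1) * (inner ℂ w (T w)).re + (ρ - 2) * ‖T w‖ ^ 2 := by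
  have hs : ∑ k ∈ range (n + 1), (T ^ k) (w - T w) = w := by
    have := congrArg (fun A : E →L[ℂ] E => A w) (geom_sum_mul_neg T (n + 1))
    simpa [hT, _root_.sum_apply] using this
  have h3 := inner_self_eq_norm_sq (𝕜 := ℂ) w
  have h4 := norm_sub_sq (𝕜 := ℂ) w (T w)
  have h5 : (inner ℂ (T w) w).re = (inner ℂ w (T w)).re := by
    rw [← inner_conj_symm, Complex.conj_re]
  simp only [RCLike.re_to_complex] at h3 h4
  rw [rhoForm, hs, inner_sub_left, Complex.sub_re, h3, h4, h5]
  ring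

end General

/-! ### Positivity and Harnack domination in terms of the form -/

section Hilbert

variable {H : Type*} [NormedAddCommGroup H] [InnerProductSpace ℂ H] [CompleteSpace H]

/-- The dilation gives `rhoForm ρ m T x = ρ (2 Re ⟨Vx, ∑ U ^ k Vx⟩ - ‖Vx‖²)`, whose sums over `m`
are nonnegative by the Fejér inequality; nilpotency makes the sequence eventually constant, so its
Cesàro limit is its final value. -/
theorem IsRhoContraction.rhoForm_nonneg {ρ : ℝ} (hρ : 0 ≤ ρ) {n : ℕ} {T : H →L[ℂ] H}
    (hT : IsRhoContraction ρ T) (hn : T ^ (n + 1) = 0) (x : H) : 0 ≤ rhoForm ρ n T x := by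
  obtain ⟨K, _, _, _, V, U, hU, hk⟩ := hT
  have hUn : ∀ y, ‖U y‖ ≤ ‖y‖ := fun y => (ContinuousLinearMap.norm_map_of_mem_unitary hU y).le
  refine nonneg_of_sum_nonneg_of_eventually_const
    (f := fun m => rhoForm ρ m T x) (fun m hm => rhoForm_of_le ρ hn hm x) fun N => ?_
  have h := (sq_nonneg _).trans (norm_sq_sum_pow_le U hUn (V x) N)
  refine (mul_nonneg hρ h).trans (le_of_eq ?_)
  rw [mul_sum]
  refine sum_congr rfl fun m _ => ?_
  have hin : ∀ k : ℕ, (inner ℂ x ((T ^ (k + 1)) x)).re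
      = ρ * (inner ℂ (V x) ((U ^ (k + 1)) (V x))).re := by
    intro k
    rw [hk (k + 1) (by omega)]
    simp [ContinuousLinearMap.adjoint_inner_right]
  have h3 := inner_self_eq_norm_sq (𝕜 := ℂ) x
  have h4 := inner_self_eq_norm_sq (𝕜 := ℂ) (V x)
  simp only [RCLike.re_to_complex, V.norm_map] at h3 h4
  simp only [rhoForm, sum_range_succ', inner_add_right, inner_sum, Complex.add_re, Complex.re_sum,
    hin, pow_zero, one_apply_eq_self, h3, h4, ← mul_sum, V.norm_map]
  ring

theorem re_inner_rePoly (p : Polynomial ℂ) (T : H →L[ℂ] H) (x : H) :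
    (inner ℂ x (rePoly p T x)).re = (inner ℂ x (Polynomial.aeval T p x)).re := by
  have h : (inner ℂ x ((star (Polynomial.aeval T p)) x)).re
      = (inner ℂ x (Polynomial.aeval T p x)).re := by
    rw [ContinuousLinearMap.star_eq_adjoint, ContinuousLinearMap.adjoint_inner_right,
      ← inner_conj_symm, Complex.conj_re]
  rw [rePoly, realPart_apply_coe]
  simp only [smul_apply, add_apply, inner_add_right,
    inner_smul_right_eq_smul, Complex.smul_re, Complex.add_re, h, smul_eq_mul]
  ring

theorem re_inner_rePoly_fejer (ρ : ℝ) (ζ : ℂ) (N : ℕ) (T : H →L[ℂ] H) (x : H) :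
    (inner ℂ x (rePoly (fejer ζ N) T x)).re =
      ∑ m ∈ range N, (rhoForm ρ m (ζ • T) x - (ρ - 1) * ‖x‖ ^ 2) := by
  rw [re_inner_rePoly, aeval_fejer, _root_.sum_apply, inner_sum, Complex.re_sum]
  refine sum_congr rfl fun m _ => ?_
  have h3 := inner_self_eq_norm_sq (𝕜 := ℂ) x
  simp only [RCLike.re_to_complex] at h3
  simp only [rhoForm, two_mul, sub_apply, add_apply,
    _root_.sum_apply, one_apply_eq_self, inner_sub_right,
    inner_add_right, Complex.sub_re, Complex.add_re, h3]
  ring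

theorem re_eval_fejer_nonneg {ζ : ℂ} (hζ : ‖ζ‖ ≤ 1) (N : ℕ) {z : ℂ} (hz : ‖z‖ ≤ 1) :
    0 ≤ ((fejer ζ N).eval z).re := by
  have h := (sq_nonneg _).trans (norm_sq_sum_pow_le ((ζ * z) • (1 : ℂ →L[ℂ] ℂ)) (fun x => by
    simp only [smul_apply, one_apply_eq_self, norm_smul, norm_mul]
    exact mul_le_of_le_one_left (norm_nonneg _) (mul_le_one₀ hζ (norm_nonneg _) hz)) 1 N)
  refine h.trans (le_of_eq ?_)
  simp [fejer, Polynomial.eval_finsetSum, smul_pow, mul_pow]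

theorem HarnackDominated.exists_rhoForm_le {ρ : ℝ} {n : ℕ} {T₁ T₀ : H →L[ℂ] H}
    (h : HarnackDominated ρ T₁ T₀) (h₁ : T₁ ^ (n + 1) = 0) (h₀ : T₀ ^ (n + 1) = 0) :
    ∃ c : ℝ, ∀ (ζ : ℂ) (x : H), ‖ζ‖ ≤ 1 →
      rhoForm ρ n (ζ • T₁) x ≤ c ^ 2 * rhoForm ρ n (ζ • T₀) x := by
  obtain ⟨-, -, c, -, hc⟩ := h
  refine ⟨c, fun ζ x hζ => sub_nonneg.1 ?_⟩
  have e₁ : (ζ • T₁) ^ (n + 1) = 0 := by rw [smul_pow, h₁, smul_zero]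
  have e₀ : (ζ • T₀) ^ (n + 1) = 0 := by rw [smul_pow, h₀, smul_zero]
  refine nonneg_of_sum_nonneg_of_eventually_const (n := n)
    (f := fun m => c ^ 2 * rhoForm ρ m (ζ • T₀) x - rhoForm ρ m (ζ • T₁) x)
    (fun m hm => by rw [rhoForm_of_le ρ e₁ hm, rhoForm_of_le ρ e₀ hm]) fun N => ?_
  -- Each summand of the Fejér form is `rhoForm` minus `(ρ - 1)‖x‖²`, and equals `‖x‖²` at the zero
  -- operator. The term `(c² - 1)(ρ - 1) Re p(0)` thus cancels these shifts exactly.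
  have hle := hc (fejer ζ N) fun z hz => re_eval_fejer_nonneg hζ N hz
  rw [ContinuousLinearMap.le_def] at hle
  have hx := hle.re_inner_nonneg_right x
  simp only [RCLike.re_to_complex, sub_apply, add_apply,
    smul_apply, inner_sub_right, inner_add_right, Complex.sub_re,
    Complex.add_re, inner_smul_right, Complex.re_ofReal_mul, re_inner_rePoly_fejer ρ,
    smul_zero, rhoForm_zero, sum_sub_distrib, sum_const, card_range, nsmul_eq_mul] at hx
  rw [sum_sub_distrib, ← mul_sum]
  linarith

theorem star_mul_mul_pow {R : Type*} [Ring R] [StarRing R] {U : R} (hU : U ∈ unitary R) (T : R)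
    (k : ℕ) : (star U * T * U) ^ k = star U * T ^ k * U := by
  induction k with
  | zero => simp [Unitary.star_mul_self_of_mem hU]
  | succ k ih =>
    rw [pow_succ, ih, pow_succ]
    calc star U * T ^ k * U * (star U * T * U) = star U * T ^ k * (U * star U) * T * U := by
          noncomm_ring
      _ = _ := by rw [Unitary.mul_star_self_of_mem hU]; noncomm_ring

theorem rhoForm_conj (ρ : ℝ) (n : ℕ) {T U : H →L[ℂ] H} (hU : U ∈ unitary (H →L[ℂ] H)) (x : H) :
    rhoForm ρ n (star U * T * U) x = rhoForm ρ n T (U x) := by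
  simp only [rhoForm, star_mul_mul_pow hU]
  simp only [inner_sum, mul_apply_eq_comp, ContinuousLinearMap.star_eq_adjoint,
    ContinuousLinearMap.adjoint_inner_right, ContinuousLinearMap.norm_map_of_mem_unitary hU]

theorem harnackDominated_refl {ρ : ℝ} {T : H →L[ℂ] H} (hT : IsRhoContraction ρ T) :
    HarnackDominated ρ T T :=
  ⟨hT, hT, 1, le_rfl, fun p _ => by simp⟩

end Hilbert

/-! ### Coordinates of the truncated shift and its powers -/

section Shift

variable {m : ℕ}

/-- The extension by zero of a vector of `ℂ ^ m` to a sequence. -/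
def zeroExtend (x : EuclideanSpace ℂ (Fin m)) (i : ℕ) : ℂ :=
  if h : i < m then x ⟨i, h⟩ else 0

@[simp]
theorem zeroExtend_val (x : EuclideanSpace ℂ (Fin m)) (i : Fin m) : zeroExtend x i = x i := by
  simp [zeroExtend]

theorem zeroExtend_of_le (x : EuclideanSpace ℂ (Fin m)) {i : ℕ} (h : m ≤ i) :
    zeroExtend x i = 0 := by
  simp [zeroExtend, h]

theorem truncatedShift_apply (b : ℂ) (x : EuclideanSpace ℂ (Fin m)) (i : Fin m) :
    truncatedShift m b x i = b * zeroExtend x (i + 1) := by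
  simp only [truncatedShift, Matrix.ofLp_toEuclideanCLM, Matrix.mulVec, dotProduct,
    Matrix.of_apply, ite_mul, zero_mul]
  by_cases h : (i : ℕ) + 1 < m
  · rw [sum_eq_single ⟨i + 1, h⟩]
    · simp [zeroExtend, h]
    · intro j _ hj
      rw [if_neg fun h' => hj (Fin.ext h'.symm)]
    · simp
  · rw [zeroExtend_of_le x (not_lt.1 h), mul_zero]
    exact sum_eq_zero fun j _ => if_neg (by omega)

theorem zeroExtend_truncatedShift (b : ℂ) (x : EuclideanSpace ℂ (Fin m)) (i : ℕ) :
    zeroExtend (truncatedShift m b x) i = b * zeroExtend x (i + 1) := by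
  by_cases h : i < m
  · exact (zeroExtend_val _ ⟨i, h⟩).trans (truncatedShift_apply b x ⟨i, h⟩)
  · rw [zeroExtend_of_le _ (not_lt.1 h), zeroExtend_of_le _ (by omega), mul_zero]

theorem zeroExtend_truncatedShift_pow (b : ℂ) (k : ℕ) (x : EuclideanSpace ℂ (Fin m)) (i : ℕ) :
    zeroExtend ((truncatedShift m b ^ k) x) i = b ^ k * zeroExtend x (i + k) := by
  induction k generalizing i with
  | zero => simp
  | succ k ih =>
    rw [pow_succ', mul_apply_eq_comp, zeroExtend_truncatedShift, ih, pow_succ', mul_assoc,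
      show i + 1 + k = i + (k + 1) by ring]

theorem truncatedShift_pow_apply (b : ℂ) (k : ℕ) (x : EuclideanSpace ℂ (Fin m)) (i : Fin m) :
    (truncatedShift m b ^ k) x i = b ^ k * zeroExtend x (i + k) := by
  rw [← zeroExtend_val, zeroExtend_truncatedShift_pow]

theorem truncatedShift_pow_self (b : ℂ) : truncatedShift m b ^ m = 0 := by
  ext x i
  rw [truncatedShift_pow_apply, zeroExtend_of_le x (Nat.le_add_left _ _)]
  simp

theorem smul_truncatedShift (c b : ℂ) : c • truncatedShift m b = truncatedShift m (c * b) := by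
  ext x i
  simp [truncatedShift_apply, mul_assoc]

theorem zeroExtend_single (j : Fin m) (i : ℕ) :
    zeroExtend (EuclideanSpace.single j (1 : ℂ)) i = if i = j then 1 else 0 := by
  by_cases h : i < m
  · simp [zeroExtend, h, Fin.ext_iff]
  · rw [zeroExtend_of_le _ (not_lt.1 h), if_neg]
    have := j.2
    omega

theorem inner_single_truncatedShift_pow_single (b : ℂ) (k : ℕ) (i j : Fin m) :
    inner ℂ (EuclideanSpace.single i (1 : ℂ))
      ((truncatedShift m b ^ k) (EuclideanSpace.single j 1)) =
      if (i : ℕ) + k = j then b ^ k else 0 := by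
  rw [EuclideanSpace.inner_single_left, truncatedShift_pow_apply, zeroExtend_single]
  simp

end Shift

/-! ### An explicit unitary dilation of a truncated shift -/

section Dilation

variable {ι : Type*} {K : Type*} [NormedAddCommGroup K] [InnerProductSpace ℂ K] [CompleteSpace K]

/-- A permutation of a Hilbert basis extends to a unitary operator. -/
theorem HilbertBasis.exists_unitary_apply (B : HilbertBasis ι ℂ K) (σ : Equiv.Perm ι) :
    ∃ U ∈ unitary (K →L[ℂ] K), ∀ i, U (B i) = B (σ i) := by
  classical
  have hd : ⊤ ≤ (Submodule.span ℂ (Set.range (B ∘ σ))).topologicalClosure := by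
    rw [σ.surjective.range_comp]
    exact B.dense_span.ge
  let B' := HilbertBasis.mk (B.orthonormal.comp σ σ.injective) hd
  refine ⟨Unitary.linearIsometryEquiv.symm (B.repr.trans B'.repr.symm), SetLike.coe_mem _,
    fun i => ?_⟩
  have : B' i = B (σ i) := by simp [B']
  rw [← this, Unitary.coe_symm_linearIsometryEquiv_apply]
  change B'.repr.symm (B.repr (B i)) = B' i
  rw [B.repr_self, B'.repr_symm_single]

omit [CompleteSpace K] in
theorem sum_smul_orthonormal_inner {κ : Type*} [Fintype κ] {B : ℤ × κ → K} (hB : Orthonormal ℂ B)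
    (s t : ℤ) (x y : EuclideanSpace ℂ κ) :
    inner ℂ (∑ l, x l • B (s, l)) (∑ l, y l • B (t, l)) = if s = t then inner ℂ x y else 0 := by
  classical
  simp only [sum_inner, inner_sum, inner_smul_left, inner_smul_right, orthonormal_iff_ite.1 hB,
    Prod.mk.injEq]
  split_ifs with h
  · simp [h, PiLp.inner_apply, mul_comm]
  · simp [h]

/-- The operator `G`, which is `ρ⁻¹` times that of the form, is a positive Toeplitz matrix with unit
diagonal. With `R = √G`, put `V e_j = δ_j ⊗ R e_j` in `ℓ²(ℤ) ⊗ ℂ^(n+1)` and let `U` be the bilateral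
shift `δ_t ↦ δ_{t-1}`. The `δ_j` make `V` isometric, and `⟨V e_i, U ^ k V e_j⟩` is the entry `G_ij`
if `i + k = j` and zero otherwise. -/
theorem isRhoContraction_truncatedShift {ρ : ℝ} (hρ : 0 < ρ) {n : ℕ} (b : ℝ)
    (h : ∀ x, 0 ≤ rhoForm ρ n (truncatedShift (n + 1) b) x) :
    IsRhoContraction ρ (truncatedShift (n + 1) b) := by
  set E := EuclideanSpace ℂ (Fin (n + 1))
  set S : E →L[ℂ] E := truncatedShift (n + 1) b with hS
  set A : E →L[ℂ] E := ∑ k ∈ range (n + 1), S ^ k with hA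
  set G : E →L[ℂ] E := (ρ⁻¹ : ℂ) • (((ρ - 2 : ℝ) : ℂ) • 1 + A + star A) with hG
  have hGpos : 0 ≤ G := by
    rw [ContinuousLinearMap.nonneg_iff_isPositive, ContinuousLinearMap.isPositive_def']
    have hr : ∀ r : ℝ, IsSelfAdjoint (r : ℂ) := Complex.conj_ofReal
    have hsa : IsSelfAdjoint G := by
      rw [hG, add_assoc, ← Complex.ofReal_inv]
      exact (hr _).smul (((hr _).smul (.one _)).add (.add_star_self A))
    refine ⟨hsa, fun x => ?_⟩
    have h1 := h x
    have h3 := inner_self_eq_norm_sq (𝕜 := ℂ) x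
    simp only [RCLike.re_to_complex] at h3
    have h4 : (inner ℂ (A x) x).re = (inner ℂ x (A x)).re := by
      rw [← inner_conj_symm, Complex.conj_re]
    rw [ContinuousLinearMap.reApplyInnerSelf_apply]
    simp only [hG, smul_apply, add_apply, one_apply_eq_self, inner_smul_left, inner_add_left,
      ContinuousLinearMap.star_eq_adjoint, ContinuousLinearMap.adjoint_inner_left,
      RCLike.re_to_complex, ← Complex.ofReal_inv, Complex.conj_ofReal, Complex.re_ofReal_mul,
      Complex.add_re, h3, h4]
    refine mul_nonneg (inv_nonneg.2 hρ.le) ?_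
    rw [rhoForm, ← _root_.sum_apply, ← hA] at h1
    linarith
  set R := CFC.sqrt G
  have hR : ∀ x y, inner ℂ (R x) (R y) = inner ℂ x (G y) := by
    intro x y
    have hsa : IsSelfAdjoint R := (CFC.sqrt_nonneg G).isSelfAdjoint
    have hRR : G y = R (R y) := by
      rw [← mul_apply_eq_comp, CFC.sqrt_mul_sqrt_self G hGpos]
    rw [hRR, ← ContinuousLinearMap.adjoint_inner_left R (R y) x,
      ← ContinuousLinearMap.star_eq_adjoint, hsa.star_eq]
  have hGe : ∀ (k : ℕ) (i j : Fin (n + 1)), (i : ℕ) + k = j →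
      inner ℂ (EuclideanSpace.single i (1 : ℂ)) (G (EuclideanSpace.single j 1))
        = if k = 0 then 1 else (ρ : ℂ)⁻¹ * (b : ℂ) ^ k := by
    intro k i j hk
    have hA1 : ∀ i j : Fin (n + 1), inner ℂ (EuclideanSpace.single i (1 : ℂ))
        (A (EuclideanSpace.single j 1)) =
          ∑ k ∈ range (n + 1), if (i : ℕ) + k = j then (b : ℂ) ^ k else 0 := by
      intro i j
      rw [hA, _root_.sum_apply, inner_sum]
      exact sum_congr rfl fun k _ => inner_single_truncatedShift_pow_single _ _ _ _
    have hA2 : ∀ (k : ℕ) (i j : Fin (n + 1)), (i : ℕ) + k = j →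
        inner ℂ (EuclideanSpace.single i (1 : ℂ)) (A (EuclideanSpace.single j 1)) = (b : ℂ) ^ k := by
      intro k i j hk
      have hj := j.2
      rw [hA1, sum_eq_single k, if_pos hk]
      · intro l _ hl
        rw [if_neg (by omega)]
      · intro hk'
        rw [mem_range] at hk'
        omega
    have hA3 : inner ℂ (EuclideanSpace.single i (1 : ℂ)) (star A (EuclideanSpace.single j 1))
        = if k = 0 then 1 else 0 := by
      rw [ContinuousLinearMap.star_eq_adjoint, ContinuousLinearMap.adjoint_inner_right,
        ← inner_conj_symm]
      split_ifs with h0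
      · rw [hA2 0 j i (by omega)]
        simp
      · rw [hA1, sum_eq_zero fun l _ => if_neg (by omega), map_zero]
    simp only [hG, smul_apply, add_apply, one_apply_eq_self, inner_smul_right, inner_add_right,
      hA2 k i j hk, hA3]
    have hρ' : (ρ : ℂ) ≠ 0 := by exact_mod_cast hρ.ne'
    by_cases h0 : k = 0
    · have : i = j := Fin.ext (by omega)
      subst this
      simp [h0]
      field_simp
      ring
    · have : inner ℂ (EuclideanSpace.single i (1 : ℂ)) (EuclideanSpace.single j 1) = 0 := by
        rw [EuclideanSpace.inner_single_left, PiLp.single_apply, if_neg (fun h => h0 (by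
          rw [h] at hk; omega)), mul_zero]
      simp [h0, this]
  let K := lp (fun _ : ℤ × Fin (n + 1) => ℂ) 2
  let B : HilbertBasis (ℤ × Fin (n + 1)) ℂ K := ⟨LinearIsometryEquiv.refl ℂ _⟩
  obtain ⟨U, hU, hUB⟩ := HilbertBasis.exists_unitary_apply B
    ((Equiv.subRight (1 : ℤ)).prodCongr (Equiv.refl (Fin (n + 1))))
  have hUpow : ∀ (k : ℕ) (t : ℤ) (x : E),
      (U ^ k) (∑ l, x l • B (t, l)) = ∑ l, x l • B (t - k, l) := by
    intro k t x
    induction k with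
    | zero => simp
    | succ k ih =>
      rw [pow_succ', mul_apply_eq_comp, ih, map_sum]
      refine sum_congr rfl fun l _ => ?_
      rw [map_smul, hUB]
      simp [sub_sub]
  let e := EuclideanSpace.basisFun (Fin (n + 1)) ℂ
  let f : E →ₗ[ℂ] K := e.toBasis.constr ℂ fun j => ∑ l, (R (e j)) l • B ((j : ℤ), l)
  have hfe : ∀ j, f (e j) = ∑ l, (R (e j)) l • B ((j : ℤ), l) := by
    intro j
    have := e.toBasis.constr_basis ℂ (fun j => ∑ l, (R (e j)) l • B ((j : ℤ), l)) j
    rwa [e.coe_toBasis] at this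
  have hf : Orthonormal ℂ (f ∘ e.toBasis) := by
    rw [orthonormal_iff_ite]
    intro i j
    simp only [Function.comp_apply, e.coe_toBasis, hfe, sum_smul_orthonormal_inner B.orthonormal]
    by_cases hij : i = j
    · subst hij
      rw [if_pos rfl, if_pos rfl, hR]
      simpa [e] using hGe 0 i i rfl
    · rw [if_neg hij, if_neg (by exact_mod_cast fun h => hij (Fin.ext h))]
  let V : E →ₗᵢ[ℂ] K := f.isometryOfOrthonormal (by simp [e.orthonormal]) hf
  have hVe : ∀ j, V (e j) = ∑ l, (R (e j)) l • B ((j : ℤ), l) := hfe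
  refine ⟨K, inferInstance, inferInstance, inferInstance, V, U, hU, fun k hk => ?_⟩
  refine ContinuousLinearMap.coe_injective (e.toBasis.ext fun j => ?_)
  refine InnerProductSpace.ext_inner_left_basis e.toBasis fun i => ?_
  simp only [e.coe_toBasis, ContinuousLinearMap.coe_coe, smul_apply, inner_smul_right,
    ContinuousLinearMap.comp_apply, ContinuousLinearMap.adjoint_inner_right,
    LinearIsometry.coe_toContinuousLinearMap, hVe, hUpow,
    sum_smul_orthonormal_inner B.orthonormal, hR]
  have hS2 := inner_single_truncatedShift_pow_single (b : ℂ) k i j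
  simp only [e, EuclideanSpace.basisFun_apply]
  rw [hS2]
  by_cases hij : (i : ℕ) + k = j
  · rw [if_pos hij, if_pos (by omega), hGe k i j hij, if_neg (by omega), mul_inv_cancel_left₀]
    exact_mod_cast hρ.ne'
  · rw [if_neg hij, if_neg (by omega), mul_zero]

end Dilation

/-! ### The critical entry `a` and degeneracy of the form there -/

section Radius

theorem rhoForm_smul {E : Type*} [NormedAddCommGroup E] [InnerProductSpace ℂ E] (ρ : ℝ) (m : ℕ)
    (T : E →L[ℂ] E) (c : ℂ) (x : E) : rhoForm ρ m T (c • x) = ‖c‖ ^ 2 * rhoForm ρ m T x := by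
  simp only [rhoForm, map_smul, ← smul_sum, inner_smul_left, inner_smul_right, norm_smul,
    ← mul_assoc, Complex.mul_conj']
  rw [← Complex.ofReal_pow, Complex.re_ofReal_mul]
  ring

theorem IsRhoContraction.norm_apply_le {H : Type*} [NormedAddCommGroup H] [InnerProductSpace ℂ H]
    [CompleteSpace H] {ρ : ℝ} (hρ : 0 ≤ ρ) {T : H →L[ℂ] H} (hT : IsRhoContraction ρ T) (x : H) :
    ‖T x‖ ≤ ρ * ‖x‖ := by
  obtain ⟨K, _, _, _, V, U, hU, hk⟩ := hT
  have h1 := hk 1 le_rfl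
  rw [pow_one, pow_one] at h1
  rw [h1, smul_apply, norm_smul, Complex.norm_real, Real.norm_of_nonneg hρ]
  refine mul_le_mul_of_nonneg_left ?_ hρ
  have h2 : ‖ContinuousLinearMap.adjoint V.toContinuousLinearMap‖ ≤ 1 := by
    rw [LinearIsometryEquiv.norm_map]
    exact V.norm_toContinuousLinearMap_le
  refine (ContinuousLinearMap.le_of_opNorm_le _ h2 _).trans ?_
  simp [ContinuousLinearMap.norm_map_of_mem_unitary hU]

variable {n : ℕ}

theorem continuous_rhoForm_truncatedShift (ρ : ℝ) :
    Continuous fun p : ℝ × EuclideanSpace ℂ (Fin (n + 1)) =>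
      rhoForm ρ n (truncatedShift (n + 1) (p.1 : ℂ)) p.2 := by
  have h : ∀ b : ℂ, truncatedShift (n + 1) b = b • truncatedShift (n + 1) 1 := fun b => by
    rw [smul_truncatedShift, mul_one]
  simp only [rhoForm]
  simp_rw [h (Complex.ofReal _), smul_pow, smul_apply]
  fun_prop

theorem continuous_rhoForm_truncatedShift_left (ρ : ℝ) (x : EuclideanSpace ℂ (Fin (n + 1))) :
    Continuous fun b : ℝ => rhoForm ρ n (truncatedShift (n + 1) (b : ℂ)) x := by
  have h : Continuous fun b : ℝ => (b, x) := by fun_prop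
  simpa only [Function.comp_def] using (continuous_rhoForm_truncatedShift ρ).comp h

theorem isOpen_setOf_rhoForm_pos (ρ : ℝ) :
    IsOpen {b : ℝ | ∀ x ∈ Metric.sphere (0 : EuclideanSpace ℂ (Fin (n + 1))) 1,
      0 < rhoForm ρ n (truncatedShift (n + 1) (b : ℂ)) x} := by
  rw [isOpen_iff_mem_nhds]
  intro b hb
  refine (isCompact_sphere _ _).eventually_forall_of_forall_eventually fun x hx => ?_
  exact (continuous_rhoForm_truncatedShift ρ).continuousAt.eventually (lt_mem_nhds (hb x hx))

theorem rhoForm_nonneg_of_sphere {ρ : ℝ} {T : EuclideanSpace ℂ (Fin (n + 1)) →L[ℂ] _}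
    (h : ∀ x ∈ Metric.sphere (0 : EuclideanSpace ℂ (Fin (n + 1))) 1, 0 < rhoForm ρ n T x)
    (x : EuclideanSpace ℂ (Fin (n + 1))) : 0 ≤ rhoForm ρ n T x := by
  by_cases hx : x = 0
  · simp [hx, rhoForm]
  · have hx' := norm_ne_zero_iff.2 hx
    have h1 := h (((‖x‖⁻¹ : ℝ) : ℂ) • x) (by simp [norm_smul, hx'])
    rw [rhoForm_smul] at h1
    exact (pos_of_mul_pos_right h1 (by positivity)).le

theorem isRhoContraction_truncatedShift_iff {ρ : ℝ} (hρ : 0 < ρ) (b : ℝ) :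
    IsRhoContraction ρ (truncatedShift (n + 1) (b : ℂ)) ↔
      ∀ x, 0 ≤ rhoForm ρ n (truncatedShift (n + 1) (b : ℂ)) x :=
  ⟨fun h => h.rhoForm_nonneg hρ.le (truncatedShift_pow_self _),
    isRhoContraction_truncatedShift hρ b⟩

theorem exists_normalizedShift_eq {ρ : ℝ} (hρ : 0 < ρ) (hn : 0 < n) :
    ∃ a : ℝ, 0 < a ∧ normalizedShift ρ (n + 1) = truncatedShift (n + 1) (a : ℂ) ∧
      (∀ x, 0 ≤ rhoForm ρ n (truncatedShift (n + 1) (a : ℂ)) x) ∧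
      ∃ x, x ≠ 0 ∧ rhoForm ρ n (truncatedShift (n + 1) (a : ℂ)) x = 0 := by
  set s : Set ℝ := {γ | 0 < γ ∧ IsRhoContraction ρ ((γ : ℂ)⁻¹ • truncatedShift (n + 1) 1)} with hs
  have hmem : ∀ γ : ℝ, γ ∈ s ↔
      0 < γ ∧ ∀ x, 0 ≤ rhoForm ρ n (truncatedShift (n + 1) ((γ⁻¹ : ℝ) : ℂ)) x := by
    intro γ
    rw [← isRhoContraction_truncatedShift_iff hρ, hs, Set.mem_ofPred_eq, smul_truncatedShift,
      mul_one, Complex.ofReal_inv]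
  -- A `ρ`-contraction has norm at most `ρ`; testing on the second basis vector keeps the infimum
  -- away from `0`.
  have hlow : ∀ γ ∈ s, ρ⁻¹ ≤ γ := by
    intro γ hγ
    obtain ⟨h0, h1⟩ := hγ
    have h2 := h1.norm_apply_le hρ.le (EuclideanSpace.single ⟨1, by omega⟩ 1)
    have h3 := PiLp.norm_apply_le (((γ : ℂ)⁻¹ • truncatedShift (n + 1) 1)
      (EuclideanSpace.single ⟨1, by omega⟩ 1)) (0 : Fin (n + 1))
    rw [smul_truncatedShift, truncatedShift_apply, zeroExtend_single] at h3
    rw [smul_truncatedShift] at h2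
    have h4 := h3.trans h2
    simp [abs_of_pos h0] at h4
    exact inv_le_of_inv_le₀ h0 h4
  have hbdd : BddBelow s := ⟨_, hlow⟩
  have hopen := isOpen_setOf_rhoForm_pos (n := n) ρ
  have hne : s.Nonempty := by
    have h0 : ∀ᶠ b : ℝ in 𝓝 0, ∀ x ∈ Metric.sphere (0 : EuclideanSpace ℂ (Fin (n + 1))) 1,
        0 < rhoForm ρ n (truncatedShift (n + 1) (b : ℂ)) x := by
      refine hopen.mem_nhds fun x hx => ?_
      have : truncatedShift (n + 1) ((0 : ℝ) : ℂ) = 0 := by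
        rw [← zero_smul ℂ (truncatedShift (n + 1) 1), smul_truncatedShift]
        simp
      rw [this, rhoForm_zero, mem_sphere_zero_iff_norm.1 hx]
      simpa
    obtain ⟨b, hb, hb0⟩ :=
      ((eventually_nhdsWithin_of_eventually_nhds (s := Set.Ioi 0) h0).and self_mem_nhdsWithin).exists
    exact ⟨b⁻¹, (hmem _).2 ⟨inv_pos.2 hb0, by rw [inv_inv]; exact rhoForm_nonneg_of_sphere hb⟩⟩
  have hw0 : 0 < sInf s := (inv_pos.2 hρ).trans_le (le_csInf hne hlow)
  have hinv : Tendsto (fun γ : ℝ => γ⁻¹) (𝓝 (sInf s)) (𝓝 (sInf s)⁻¹) := tendsto_inv₀ hw0.ne'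
  have hpos : ∀ x, 0 ≤ rhoForm ρ n (truncatedShift (n + 1) (((sInf s)⁻¹ : ℝ) : ℂ)) x := by
    intro x
    by_contra! hx
    have hcont := continuous_rhoForm_truncatedShift_left ρ x
    have hev : ∀ᶠ γ : ℝ in 𝓝 (sInf s),
        rhoForm ρ n (truncatedShift (n + 1) ((γ⁻¹ : ℝ) : ℂ)) x < 0 :=
      hinv.eventually (hcont.continuousAt.eventually_lt continuousAt_const hx)
    have hfr := mem_closure_iff_frequently.1 (csInf_mem_closure hne hbdd)
    obtain ⟨γ, hγ, h2⟩ := (hfr.and_eventually hev).exists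
    exact (((hmem γ).1 hγ).2 x).not_gt h2
  refine ⟨(sInf s)⁻¹, inv_pos.2 hw0, rfl, hpos, ?_⟩
  -- Without a null vector the form is positive on the compact unit sphere, and stays so for some
  -- `γ` below the infimum.
  by_contra! hcon
  have h1 : (sInf s)⁻¹ ∈ {b : ℝ | ∀ x ∈ Metric.sphere (0 : EuclideanSpace ℂ (Fin (n + 1))) 1,
      0 < rhoForm ρ n (truncatedShift (n + 1) (b : ℂ)) x} := fun x hx =>
    (hpos x).lt_of_ne' (hcon x (ne_zero_of_mem_unit_sphere ⟨x, hx⟩))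
  have h2 := (hinv.eventually (hopen.mem_nhds h1)).and (lt_mem_nhds hw0)
  obtain ⟨γ, ⟨hγ, hγ0⟩, hlt⟩ :=
    ((eventually_nhdsWithin_of_eventually_nhds (s := Set.Iio (sInf s)) h2).and
      self_mem_nhdsWithin).exists
  exact (csInf_le hbdd ((hmem γ).2 ⟨hγ0, rhoForm_nonneg_of_sphere hγ⟩)).not_gt hlt

end Radius

/-! ### The three-term recurrence -/

section Recurrence

/-- The three-term recurrence with its two boundary conditions satisfied by the coefficients of
`(1 - S)⁻¹ x` for a null vector `x` of `rhoForm ρ n S`, `S` the truncated shift with entry `a`. -/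
structure IsKernelSequence (ρ a : ℝ) (n : ℕ) (u : ℕ → ℂ) : Prop where
  zero : ρ * u 0 = (ρ - 1) * a * u 1
  succ : ∀ i < n, (ρ + (ρ - 2) * a ^ 2) * u (i + 1) = (ρ - 1) * a * (u i + u (i + 2))
  last : u (n + 1) = 0

variable {ρ a : ℝ} {n : ℕ}

theorem IsKernelSequence.eq_zero (hρ : 1 < ρ) (ha : 0 < a) {u : ℕ → ℂ}
    (hu : IsKernelSequence ρ a n u) (h0 : u 0 = 0) {i : ℕ} (hi : i ≤ n + 1) : u i = 0 := by
  have hne : ((ρ : ℂ) - 1) * a ≠ 0 := by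
    have : (ρ - 1) * a ≠ 0 := (mul_pos (sub_pos.2 hρ) ha).ne'
    exact_mod_cast this
  induction i using Nat.strong_induction_on with
  | _ i ih =>
    match i with
    | 0 => exact h0
    | 1 =>
      refine mul_left_cancel₀ hne ?_
      linear_combination ρ * h0 - hu.zero
    | i + 2 =>
      have h2 := ih (i + 1) (by omega) (by omega)
      have h1 := ih i (by omega) (by omega)
      refine mul_left_cancel₀ hne ?_
      linear_combination (ρ + (ρ - 2) * a ^ 2) * h2 - (ρ - 1) * a * h1 - hu.succ i (by omega)

/-- Solutions form a line: this combination is a solution vanishing at `0`, hence everywhere up to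
`n + 1`. -/
theorem IsKernelSequence.mul_eq_mul (hρ : 1 < ρ) (ha : 0 < a) {u w : ℕ → ℂ}
    (hu : IsKernelSequence ρ a n u) (hw : IsKernelSequence ρ a n w) {i : ℕ} (hi : i ≤ n + 1) :
    w i * u 0 = w 0 * u i := by
  have h : IsKernelSequence ρ a n fun i => w i * u 0 - w 0 * u i :=
    ⟨by linear_combination u 0 * hw.zero - w 0 * hu.zero,
      fun i hi => by linear_combination u 0 * hw.succ i hi - w 0 * hu.succ i hi,
      by linear_combination u 0 * hw.last - w 0 * hu.last⟩
  exact sub_eq_zero.1 (h.eq_zero hρ ha (by ring) hi)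

/-- A zero of a nonnegative solution forces its neighbours to vanish, and so propagates down to `u
0`. -/
theorem IsKernelSequence.pos (hρ : 1 < ρ) (ha : 0 < a) {u : ℕ → ℝ}
    (hu : IsKernelSequence ρ a n fun i => u i) (h0 : ∀ i, 0 ≤ u i) (hne : ∃ i ≤ n, u i ≠ 0) {i : ℕ}
    (hi : i ≤ n) : 0 < u i := by
  have hμ : 0 < (ρ - 1) * a := mul_pos (sub_pos.2 hρ) ha
  have hu0 : u 0 ≠ 0 := by
    intro h
    obtain ⟨j, hj, hj0⟩ := hne
    exact hj0 (by exact_mod_cast hu.eq_zero hρ ha (by exact_mod_cast h) (hj.trans n.le_succ))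
  refine (h0 i).lt_of_ne' ?_
  induction i with
  | zero => exact hu0
  | succ i ih =>
    intro h
    have h1 := hu.succ i (by omega)
    have h2 : (ρ + (ρ - 2) * a ^ 2) * u (i + 1) = (ρ - 1) * a * (u i + u (i + 2)) := by
      exact_mod_cast h1
    rw [h, mul_zero, eq_comm, mul_eq_zero, or_iff_right hμ.ne'] at h2
    exact ih (by omega) (by linarith [h0 i, h0 (i + 2)])

/-- The quantity `u (i + 1) ^ 2 - u i * u (i + 2)` does not depend on `i`; at the far end it is `u n
^ 2`, because `u (n + 1) = 0`. -/
theorem IsKernelSequence.mul_lt_sq (hρ : 1 < ρ) (ha : 0 < a) {u : ℕ → ℝ}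
    (hu : IsKernelSequence ρ a n fun i => u i) (hpos : ∀ i ≤ n, 0 < u i) {i : ℕ} (hi : i < n) :
    u i * u (i + 2) < u (i + 1) ^ 2 := by
  have hμ : 0 < (ρ - 1) * a := mul_pos (sub_pos.2 hρ) ha
  have hs : ∀ i < n, (ρ + (ρ - 2) * a ^ 2) * u (i + 1) = (ρ - 1) * a * (u i + u (i + 2)) :=
    fun i hi => by exact_mod_cast hu.succ i hi
  have hl : u (n + 1) = 0 := by exact_mod_cast hu.last
  obtain ⟨d, rfl⟩ := Nat.exists_eq_add_of_lt hi
  induction d generalizing i with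
  | zero =>
    rw [show i + 2 = i + 0 + 1 + 1 by ring, hl, mul_zero]
    exact pow_pos (hpos _ (by omega)) 2
  | succ d ih =>
    have h := @ih (i + 1) (by convert hu using 1; ring) (by convert hpos using 3; ring) (by omega)
      (by convert hs using 3; ring) (by convert hl using 2; ring)
    have h1 := hs i (by omega)
    have h2 := hs (i + 1) (by omega)
    have h3 : (ρ - 1) * a * (u (i + 1) ^ 2 - u i * u (i + 2))
        = (ρ - 1) * a * (u (i + 1 + 1) ^ 2 - u (i + 1) * u (i + 1 + 2)) := by
      linear_combination u (i + 2) * h1 - u (i + 1) * h2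
    have h4 := mul_left_cancel₀ hμ.ne' h3
    linarith

/-- Put `v i = u i - a * u (i + 1)`. The ratios `u (i + 1) / u i` strictly decrease, so `v` has at
most one zero. Reversal of indices only rescales `v`, so a zero at `i` gives one at `n - i`, which
differs from `i` as `n` is odd. -/
theorem IsKernelSequence.sub_ne_zero (hρ : 1 < ρ) (ha : 0 < a) (hn : Odd n) {u : ℕ → ℝ}
    (hu : IsKernelSequence ρ a n fun i => u i) (hpos : ∀ i ≤ n, 0 < u i) {i : ℕ} (hi : i ≤ n) :
    u i - a * u (i + 1) ≠ 0 := by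
  have hμ : 0 < (ρ - 1) * a := mul_pos (sub_pos.2 hρ) ha
  have hz : ρ * u 0 = (ρ - 1) * a * u 1 := by exact_mod_cast hu.zero
  have hs : ∀ i < n, (ρ + (ρ - 2) * a ^ 2) * u (i + 1) = (ρ - 1) * a * (u i + u (i + 2)) :=
    fun i hi => by exact_mod_cast hu.succ i hi
  have hl : u (n + 1) = 0 := by exact_mod_cast hu.last
  have hratio : ∀ i j, i < j → j ≤ n → u (j + 1) / u j < u (i + 1) / u i := by
    intro i j hij hj
    induction j, hij using Nat.le_induction with
    | base =>
      rw [div_lt_div_iff₀ (hpos _ hj) (hpos _ (by omega))]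
      linarith [hu.mul_lt_sq hρ ha hpos (i := i) (by omega)]
    | succ j hij ih =>
      refine lt_trans ?_ (ih (by omega))
      rw [div_lt_div_iff₀ (hpos _ hj) (hpos _ (by omega))]
      linarith [hu.mul_lt_sq hρ ha hpos (i := j) (by omega)]
  have hunique : ∀ i j, i < j → j ≤ n → u i - a * u (i + 1) = 0 → u j - a * u (j + 1) = 0 →
      False := by
    intro i j hij hj h1 h2
    have h := hratio i j hij hj
    rw [div_lt_div_iff₀ (hpos _ hj) (hpos _ (by omega))] at h
    have h3 := mul_lt_mul_of_pos_left h ha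
    have h4 : a * (u (j + 1) * u i) = a * (u (i + 1) * u j) := by
      linear_combination u j * h1 - u i * h2
    exact h3.ne h4
  -- `v` satisfies the same interior recurrence, and at both ends the ratio of the second entry to
  -- the end entry is `(ρ - a²) / ((ρ - 1) a)`; hence the symmetry.
  have hpal : ∀ i j, i + j = n → (u j - a * u (j + 1)) * (u 0 - a * u 1)
      = (u i - a * u (i + 1)) * (u n - a * u (n + 1)) := by
    intro i
    induction i using Nat.strong_induction_on with
    | _ i ih =>
      intro j hij
      match i with
      | 0 =>
        obtain rfl : j = n := by omega
        simp [mul_comm]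
      | 1 =>
        obtain rfl : n = j + 1 := by omega
        have e1 := hs 0 (by omega)
        have e2 := hs j (by omega)
        have f1 : (ρ - 1) * a * (u 1 - a * u 2) = (ρ - a ^ 2) * (u 0 - a * u 1) := by
          linear_combination a * e1 + (a ^ 2 - 1) * hz
        have f2 : (ρ - 1) * a * (u j - a * u (j + 1)) = (ρ - a ^ 2) * u (j + 1) := by
          linear_combination -e2 - (ρ - 1) * a * hl
        refine mul_left_cancel₀ hμ.ne' ?_
        linear_combination (u 0 - a * u 1) * f2 - (u (j + 1) - a * u (j + 2)) * f1
          + (ρ - a ^ 2) * (u 0 - a * u 1) * a * hl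
      | i + 2 =>
        have h1 := ih (i + 1) (by omega) (j + 1) (by omega)
        have h0 := ih i (by omega) (j + 2) (by omega)
        have e1 := hs i (by omega)
        have e2 := hs (i + 1) (by omega)
        have e3 := hs j (by omega)
        have e4 := hs (j + 1) (by omega)
        have f1 : (ρ + (ρ - 2) * a ^ 2) * (u (i + 1) - a * u (i + 2)) = (ρ - 1) * a *
            ((u i - a * u (i + 1)) + (u (i + 2) - a * u (i + 3))) := by
          linear_combination e1 - a * e2
        have f2 : (ρ + (ρ - 2) * a ^ 2) * (u (j + 1) - a * u (j + 2)) = (ρ - 1) * a *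
            ((u j - a * u (j + 1)) + (u (j + 2) - a * u (j + 3))) := by
          linear_combination e3 - a * e4
        refine mul_left_cancel₀ hμ.ne' ?_
        linear_combination (u n - a * u (n + 1)) * f1 - (u 0 - a * u 1) * f2
          + (ρ + (ρ - 2) * a ^ 2) * h1 - (ρ - 1) * a * h0
  have hv0 : u 0 - a * u 1 ≠ 0 := by
    intro h
    have := hpos 0 (by omega)
    have : u 0 = 0 := by linear_combination hz - (ρ - 1) * h
    linarith
  intro h
  obtain ⟨j, hj⟩ := Nat.exists_eq_add_of_le hi
  have h1 := hpal i j hj.symm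
  rw [h, zero_mul, mul_eq_zero, or_iff_left hv0] at h1
  rcases lt_trichotomy i j with hlt | rfl | hlt
  · exact hunique i j hlt (by omega) h h1
  · obtain ⟨k, hk⟩ := hn
    omega
  · exact hunique j i hlt hi h1 h

end Recurrence

/-! ### The null line of the form -/

section NullVectors

theorem apply_eq_zero_of_nonneg {H : Type*} [NormedAddCommGroup H] [InnerProductSpace ℂ H]
    [CompleteSpace H] {M : H →L[ℂ] H} (hM : 0 ≤ M) {w : H} (hw : (inner ℂ w (M w)).re = 0) :
    M w = 0 := by
  set R := CFC.sqrt M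
  have hsa : IsSelfAdjoint R := (CFC.sqrt_nonneg M).isSelfAdjoint
  have hRR : M w = R (R w) := by rw [← mul_apply_eq_comp, CFC.sqrt_mul_sqrt_self M hM]
  have h3 := inner_self_eq_norm_sq (𝕜 := ℂ) (R w)
  rw [RCLike.re_to_complex] at h3
  rw [hRR, ← ContinuousLinearMap.adjoint_inner_left R (R w) w,
    ← ContinuousLinearMap.star_eq_adjoint, hsa.star_eq, h3, sq_eq_zero_iff, norm_eq_zero] at hw
  rw [hRR, hw, map_zero]

variable {ρ a : ℝ} {n : ℕ}

theorem truncatedShift_single_zero (b : ℂ) :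
    truncatedShift (n + 1) b (EuclideanSpace.single 0 1) = 0 := by
  ext i
  simp [truncatedShift_apply, zeroExtend_single]

theorem truncatedShift_single_succ (b : ℂ) (i : ℕ) (hi : i < n) :
    truncatedShift (n + 1) b (EuclideanSpace.single ⟨i + 1, by omega⟩ 1)
      = b • EuclideanSpace.single ⟨i, by omega⟩ 1 := by
  ext j
  simp [truncatedShift_apply, zeroExtend_single, Fin.ext_iff]

theorem isKernelSequence_zeroExtend
    (hpos : ∀ x, 0 ≤ rhoForm ρ n (truncatedShift (n + 1) (a : ℂ)) x)
    {w : EuclideanSpace ℂ (Fin (n + 1))}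
    (hw : rhoForm ρ n (truncatedShift (n + 1) (a : ℂ)) (w - truncatedShift (n + 1) (a : ℂ) w) = 0) :
    IsKernelSequence ρ a n (zeroExtend w) := by
  set S := truncatedShift (n + 1) (a : ℂ) with hS
  -- `M` is the tridiagonal operator of the form in the variable `w`. Being positive, it kills its
  -- null vectors; the coordinates of `M w = 0` are the recurrence.
  set M := (ρ : ℂ) • 1 + ((-(ρ - 1) : ℝ) : ℂ) • (S + star S)
    + ((ρ - 2 : ℝ) : ℂ) • (star S * S) with hM
  have hinner : ∀ x y, inner ℂ x (M y) = ρ * inner ℂ x y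
      - (ρ - 1) * (inner ℂ x (S y) + inner ℂ (S x) y) + (ρ - 2) * inner ℂ (S x) (S y) := by
    intro x y
    simp only [hM, smul_apply, add_apply, one_apply_eq_self, inner_smul_right, inner_add_right,
      mul_apply_eq_comp, ContinuousLinearMap.star_eq_adjoint,
      ContinuousLinearMap.adjoint_inner_right]
    push_cast
    ring
  have hform : ∀ x, (inner ℂ x (M x)).re = rhoForm ρ n S (x - S x) := by
    intro x
    have h3 := inner_self_eq_norm_sq (𝕜 := ℂ) x
    have h4 := inner_self_eq_norm_sq (𝕜 := ℂ) (S x)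
    have h5 : (inner ℂ (S x) x).re = (inner ℂ x (S x)).re := by
      rw [← inner_conj_symm, Complex.conj_re]
    simp only [RCLike.re_to_complex] at h3 h4
    rw [rhoForm_sub_apply ρ (truncatedShift_pow_self _), hinner]
    simp only [← Complex.ofReal_one, ← Complex.ofReal_ofNat, ← Complex.ofReal_sub, Complex.add_re,
      Complex.sub_re, Complex.re_ofReal_mul, h3, h4, h5]
    ring
  have hr : ∀ r : ℝ, IsSelfAdjoint (r : ℂ) := Complex.conj_ofReal
  have hsa : IsSelfAdjoint M :=
    (((hr _).smul (.one _)).add ((hr _).smul (.add_star_self S))).add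
      ((hr _).smul (.star_mul_self S))
  have hM0 : 0 ≤ M := by
    rw [ContinuousLinearMap.nonneg_iff_isPositive, ContinuousLinearMap.isPositive_def']
    refine ⟨hsa, fun x => ?_⟩
    rw [ContinuousLinearMap.reApplyInnerSelf_apply, ← inner_conj_symm, RCLike.conj_re,
      RCLike.re_to_complex, hform]
    exact hpos _
  have hMw := apply_eq_zero_of_nonneg hM0 ((hform w).trans hw)
  have hi : ∀ i : Fin (n + 1), ρ * w i
      - (ρ - 1) * ((a : ℂ) * zeroExtend w (i + 1) + inner ℂ (S (EuclideanSpace.single i 1)) w)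
      + (ρ - 2) * inner ℂ (S (EuclideanSpace.single i 1)) (S w) = 0 := by
    intro i
    have h := hinner (EuclideanSpace.single i 1) w
    rw [hMw, inner_zero_right, EuclideanSpace.inner_single_left, EuclideanSpace.inner_single_left,
      map_one, one_mul, one_mul, hS, truncatedShift_apply] at h
    exact h.symm
  refine ⟨?_, fun i hin => ?_, zeroExtend_of_le _ le_rfl⟩
  · have h := hi 0
    rw [hS, truncatedShift_single_zero, inner_zero_left, inner_zero_left, ← zeroExtend_val] at h
    simp only [Fin.val_zero] at h
    linear_combination h
  · have h := hi ⟨i + 1, by omega⟩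
    rw [hS, truncatedShift_single_succ _ _ hin, inner_smul_left, inner_smul_left,
      EuclideanSpace.inner_single_left, EuclideanSpace.inner_single_left, truncatedShift_apply,
      ← zeroExtend_val, ← zeroExtend_val, Complex.conj_ofReal] at h
    simp only [map_one] at h
    linear_combination h

/-- The entrywise modulus of a vector. -/
def modulus (w : EuclideanSpace ℂ (Fin (n + 1))) : EuclideanSpace ℂ (Fin (n + 1)) :=
  WithLp.toLp 2 fun i => (‖w i‖ : ℂ)

theorem zeroExtend_modulus (w : EuclideanSpace ℂ (Fin (n + 1))) (i : ℕ) :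
    zeroExtend (modulus w) i = (‖zeroExtend w i‖ : ℂ) := by
  by_cases h : i < n + 1
  · simp [zeroExtend, h, modulus]
  · simp [zeroExtend, h]

/-- Taking moduli keeps both norms and can only increase `Re ⟨w, S w⟩`, whose coefficient `-2(ρ -
1)` is negative. Hence a null vector yields a nonnegative solution of the recurrence. -/
theorem rhoForm_modulus_le (hρ : 1 < ρ) (ha : 0 < a) (w : EuclideanSpace ℂ (Fin (n + 1))) :
    rhoForm ρ n (truncatedShift (n + 1) (a : ℂ))
        (modulus w - truncatedShift (n + 1) (a : ℂ) (modulus w)) ≤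
      rhoForm ρ n (truncatedShift (n + 1) (a : ℂ)) (w - truncatedShift (n + 1) (a : ℂ) w) := by
  rw [rhoForm_sub_apply ρ (truncatedShift_pow_self _),
    rhoForm_sub_apply ρ (truncatedShift_pow_self _)]
  have h1 : ‖modulus w‖ = ‖w‖ := by simp [EuclideanSpace.norm_eq, modulus]
  have h2 : ‖truncatedShift (n + 1) (a : ℂ) (modulus w)‖ = ‖truncatedShift (n + 1) (a : ℂ) w‖ := by
    simp [EuclideanSpace.norm_eq, truncatedShift_apply, zeroExtend_modulus]
  have h3 : (inner ℂ w (truncatedShift (n + 1) (a : ℂ) w)).re ≤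
      (inner ℂ (modulus w) (truncatedShift (n + 1) (a : ℂ) (modulus w))).re := by
    simp only [PiLp.inner_apply, Complex.re_sum, truncatedShift_apply, zeroExtend_modulus]
    refine sum_le_sum fun i _ => (Complex.re_le_norm _).trans (le_of_eq ?_)
    simp only [modulus, RCLike.inner_apply, Complex.conj_ofReal, norm_mul, RCLike.norm_conj,
      Complex.norm_real, Real.norm_of_nonneg ha.le, ← Complex.ofReal_mul, Complex.ofReal_re]
  rw [h1, h2]
  have := mul_le_mul_of_nonneg_left h3 (sub_pos.2 hρ).le
  linarith

theorem exists_null_line (hρ : 1 < ρ) (ha : 0 < a) (hn : Odd n)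
    (hpos : ∀ x, 0 ≤ rhoForm ρ n (truncatedShift (n + 1) (a : ℂ)) x)
    (hnull : ∃ x, x ≠ 0 ∧ rhoForm ρ n (truncatedShift (n + 1) (a : ℂ)) x = 0) :
    ∃ v : EuclideanSpace ℂ (Fin (n + 1)), (∀ i, v i ≠ 0) ∧
      rhoForm ρ n (truncatedShift (n + 1) (a : ℂ)) v = 0 ∧
      ∀ y, rhoForm ρ n (truncatedShift (n + 1) (a : ℂ)) y = 0 → ∃ c : ℂ, y = c • v := by
  set S := truncatedShift (n + 1) (a : ℂ) with hS
  have hsub : ∀ y, ∃ w, w - S w = y := by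
    intro y
    refine ⟨∑ k ∈ range (n + 1), (S ^ k) y, ?_⟩
    have := congrArg (fun A : _ →L[ℂ] _ => A y) (mul_neg_geom_sum S (n + 1))
    simpa [hS, truncatedShift_pow_self, _root_.sum_apply] using this
  obtain ⟨x, hx0, hx⟩ := hnull
  obtain ⟨w, rfl⟩ := hsub x
  have hmod : rhoForm ρ n S (modulus w - S (modulus w)) = 0 :=
    le_antisymm ((rhoForm_modulus_le hρ ha w).trans hx.le) (hpos _)
  set u : ℕ → ℝ := fun i => ‖zeroExtend w i‖ with hu
  have hku : IsKernelSequence ρ a n fun i => (u i : ℂ) := by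
    convert isKernelSequence_zeroExtend hpos hmod using 2
    rw [zeroExtend_modulus]
  have hne : ∃ i ≤ n, u i ≠ 0 := by
    by_contra! h
    refine hx0 ?_
    have : w = 0 := by
      ext i
      have := h i (by omega)
      simpa [hu] using this
    simp [this]
  have hup : ∀ i ≤ n, 0 < u i := fun i hi =>
    hku.pos hρ ha (fun _ => norm_nonneg _) hne hi
  have hv : ∀ i : Fin (n + 1), (modulus w - S (modulus w)) i = ((u i - a * u (i + 1) : ℝ) : ℂ) := by
    intro i
    rw [PiLp.sub_apply, hS, truncatedShift_apply, ← zeroExtend_val, zeroExtend_modulus,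
      zeroExtend_modulus]
    simp [hu]
  refine ⟨modulus w - S (modulus w), fun i => ?_, hmod, fun y hy => ?_⟩
  · rw [hv]
    exact Complex.ofReal_ne_zero.2 (hku.sub_ne_zero hρ ha hn hup (by omega))
  · obtain ⟨z, rfl⟩ := hsub y
    have hkz := isKernelSequence_zeroExtend hpos hy
    have hu0 : (u 0 : ℂ) ≠ 0 := by exact_mod_cast (hup 0 n.zero_le).ne'
    refine ⟨zeroExtend z 0 / u 0, ?_⟩
    ext i
    rw [PiLp.smul_apply, hv, PiLp.sub_apply, hS, truncatedShift_apply, ← zeroExtend_val, smul_eq_mul]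
    have e1 := hku.mul_eq_mul hρ ha hkz (i := i) (by omega)
    have e2 := hku.mul_eq_mul hρ ha hkz (i := i + 1) (by omega)
    push_cast
    field_simp
    linear_combination e1 - a * e2

end NullVectors

/-! ### Rotations of the shift and rigidity of the unitary -/

section Orbit

variable {n : ℕ}

/-- The diagonal operator with entries `ζ ^ j`. -/
def phase (ζ : ℂ) (x : EuclideanSpace ℂ (Fin (n + 1))) : EuclideanSpace ℂ (Fin (n + 1)) :=
  WithLp.toLp 2 fun j => ζ ^ (j : ℕ) * x j

theorem phase_apply (ζ : ℂ) (x : EuclideanSpace ℂ (Fin (n + 1))) (j : Fin (n + 1)) :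
    phase ζ x j = ζ ^ (j : ℕ) * x j := rfl

theorem zeroExtend_phase (ζ : ℂ) (x : EuclideanSpace ℂ (Fin (n + 1))) (j : ℕ) :
    zeroExtend (phase ζ x) j = ζ ^ j * zeroExtend x j := by
  by_cases h : j < n + 1
  · simp [zeroExtend, h, phase]
  · simp [zeroExtend, h]

/-- With `D = diag (ζ ^ j)` unitary, `ζ S = D* S D`. -/
theorem rhoForm_smul_truncatedShift (ρ : ℝ) (b : ℂ) {ζ : ℂ} (hζ : ‖ζ‖ = 1)
    (x : EuclideanSpace ℂ (Fin (n + 1))) :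
    rhoForm ρ n (ζ • truncatedShift (n + 1) b) x =
      rhoForm ρ n (truncatedShift (n + 1) b) (phase ζ x) := by
  have h1 : ‖phase ζ x‖ = ‖x‖ := by simp [EuclideanSpace.norm_eq, phase_apply, hζ]
  rw [rhoForm, rhoForm, h1, inner_sum, inner_sum]
  congr 3
  refine sum_congr rfl fun k _ => ?_
  simp only [PiLp.inner_apply, smul_truncatedShift, truncatedShift_pow_apply, zeroExtend_phase,
    RCLike.inner_apply, phase_apply, map_mul, map_pow]
  refine sum_congr rfl fun i _ => ?_
  have hc : ζ ^ (i : ℕ) * (starRingEnd ℂ) ζ ^ (i : ℕ) = 1 := by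
    rw [← mul_pow, Complex.mul_conj', hζ]
    simp
  rw [mul_pow, pow_add]
  linear_combination (-(ζ ^ k * b ^ k * zeroExtend x (i + k) * (starRingEnd ℂ) (x i))) * hc

theorem infinite_unit_circle : {z : ℂ | ‖z‖ = 1}.Infinite := by
  have h : IsPreconnected (Metric.sphere (0 : ℂ) 1) :=
    isPreconnected_sphere (by rw [Complex.rank_real_complex]; norm_num) 0 1
  have h2 := h.infinite_of_nontrivial ⟨1, by simp, -1, by simp, by norm_num⟩
  simpa [Metric.sphere, dist_zero_right] using h2

/-- The entries of `U (phase η v)` are polynomials `p i` in `η` of degree at most `n`.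
Proportionality on the infinite unit circle gives `v 0 * p i = v i * X ^ i * p 0` identically. -/
theorem eq_smul_one_of_phase_eigenvector {v : EuclideanSpace ℂ (Fin (n + 1))} (hv : ∀ i, v i ≠ 0)
    {U : EuclideanSpace ℂ (Fin (n + 1)) →L[ℂ] EuclideanSpace ℂ (Fin (n + 1))}
    (h : ∀ η : ℂ, ‖η‖ = 1 → ∃ c : ℂ, U (phase η v) = c • phase η v) : ∃ c : ℂ, U = c • 1 := by
  let u : Fin (n + 1) → Fin (n + 1) → ℂ := fun i j => U (EuclideanSpace.single j 1) i
  let p : Fin (n + 1) → Polynomial ℂ := fun i =>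
    ∑ j : Fin (n + 1), Polynomial.monomial (j : ℕ) (v j * u i j)
  have hU : ∀ (x : EuclideanSpace ℂ (Fin (n + 1))) i, U x i = ∑ j, x j * u i j := by
    intro x i
    have hx : x = ∑ j, x j • EuclideanSpace.single j (1 : ℂ) := by
      simpa using ((EuclideanSpace.basisFun (Fin (n + 1)) ℂ).sum_repr x).symm
    conv_lhs => rw [hx, map_sum]
    simp [u]
  have hcoeff : ∀ i j : Fin (n + 1), (p i).coeff j = v j * u i j := by
    intro i j
    simp [p, Polynomial.finsetSum_coeff, Polynomial.coeff_monomial, ← Fin.ext_iff]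
  have hcoeff' : ∀ (i : Fin (n + 1)) (k : ℕ), n < k → (p i).coeff k = 0 := by
    intro i k hk
    simp only [p, Polynomial.finsetSum_coeff, Polynomial.coeff_monomial]
    exact sum_eq_zero fun j _ => if_neg (by omega)
  have heval : ∀ (i : Fin (n + 1)) (η : ℂ), (p i).eval η = U (phase η v) i := by
    intro i η
    rw [hU]
    simp only [p, Polynomial.eval_finsetSum, Polynomial.eval_monomial, phase_apply]
    exact sum_congr rfl fun j _ => by ring
  have hp : ∀ i : Fin (n + 1), Polynomial.C (v 0) * p i =
      Polynomial.C (v i) * (p 0 * Polynomial.X ^ (i : ℕ)) := by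
    intro i
    refine Polynomial.eq_of_infinite_eval_eq _ _ (infinite_unit_circle.mono fun η hη => ?_)
    obtain ⟨c, hc⟩ := h η hη
    simp only [Set.mem_ofPred_eq, Polynomial.eval_mul, Polynomial.eval_C, heval, hc,
      PiLp.smul_apply, phase_apply, Polynomial.eval_pow, Polynomial.eval_X, smul_eq_mul]
    simp
    ring
  -- The case `i = n`: a nonconstant term of `p 0` would give `p n` degree above `n`. So `p 0` is
  -- constant and `p i` is a multiple of `X ^ i`.
  have hu0 : ∀ j : Fin (n + 1), j ≠ 0 → u 0 j = 0 := by
    intro j hj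
    have h1 := congrArg (fun q => q.coeff ((j : ℕ) + n)) (hp (Fin.last n))
    have hj' : (j : ℕ) ≠ 0 := fun h => hj (Fin.ext h)
    simp only [Polynomial.coeff_C_mul, Fin.val_last, Polynomial.coeff_mul_X_pow, hcoeff] at h1
    rw [hcoeff' _ _ (by omega), mul_zero, eq_comm] at h1
    simpa [hv] using h1
  have hp0 : p 0 = Polynomial.C (v 0 * u 0 0) := by
    simp only [p]
    rw [sum_eq_single 0 (fun j _ hj => by rw [hu0 j hj, mul_zero, map_zero]) (by simp)]
    simp
  have hu : ∀ i j, u i j = if i = j then u 0 0 else 0 := by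
    intro i j
    have h1 := congrArg (fun q => q.coeff (j : ℕ)) (hp i)
    simp only [hp0, Polynomial.coeff_C_mul, Polynomial.coeff_X_pow, hcoeff] at h1
    refine mul_left_cancel₀ (hv j) (mul_left_cancel₀ (hv 0) (h1.trans ?_))
    by_cases hij : i = j
    · subst hij
      simp
      ring
    · rw [if_neg (fun h => hij (Fin.ext h.symm)), if_neg hij]
      simp
  refine ⟨u 0 0, ?_⟩
  ext x i
  rw [hU, sum_eq_single i (fun j _ hj => by rw [hu, if_neg hj.symm, mul_zero]) (by simp), hu,
    if_pos rfl, smul_apply, one_apply_eq_self, PiLp.smul_apply, smul_eq_mul, mul_comm]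

theorem eq_of_harnackDominated_conj {ρ : ℝ} (hρ : 1 < ρ) {a : ℝ} (ha : 0 < a) (hn : Odd n)
    (hpos : ∀ x, 0 ≤ rhoForm ρ n (truncatedShift (n + 1) (a : ℂ)) x)
    (hnull : ∃ x, x ≠ 0 ∧ rhoForm ρ n (truncatedShift (n + 1) (a : ℂ)) x = 0)
    {U : EuclideanSpace ℂ (Fin (n + 1)) →L[ℂ] EuclideanSpace ℂ (Fin (n + 1))}
    (hU : U ∈ unitary (EuclideanSpace ℂ (Fin (n + 1)) →L[ℂ] EuclideanSpace ℂ (Fin (n + 1))))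
    (h : HarnackDominated ρ (star U * truncatedShift (n + 1) (a : ℂ) * U)
      (truncatedShift (n + 1) (a : ℂ))) :
    star U * truncatedShift (n + 1) (a : ℂ) * U = truncatedShift (n + 1) (a : ℂ) := by
  set S := truncatedShift (n + 1) (a : ℂ) with hS
  have hSn : S ^ (n + 1) = 0 := truncatedShift_pow_self _
  have hconj : ∀ k : ℕ, (star U * S * U) ^ k = star U * S ^ k * U := fun k =>
    star_mul_mul_pow hU S k
  obtain ⟨v, hv, hv0, hline⟩ := exists_null_line hρ ha hn hpos hnull
  obtain ⟨c, hc⟩ := h.exists_rhoForm_le (n := n) (by rw [hconj, hSn, mul_zero, zero_mul]) hSn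
  obtain ⟨d, rfl⟩ : ∃ d : ℂ, U = d • 1 := by
    refine eq_smul_one_of_phase_eigenvector hv fun η hη => ?_
    have hη0 : η ≠ 0 := norm_ne_zero_iff.1 (by rw [hη]; norm_num)
    have hζ : ‖η⁻¹‖ = 1 := by rw [norm_inv, hη, inv_one]
    have hphase : phase η⁻¹ (phase η v) = v := by
      ext i
      simp [phase_apply, hη0]
    -- The vector `phase η v` is null for `η⁻¹ S`. Domination passes this to `η⁻¹ U* S U`, so `U
    -- (phase η v)` is null for `η⁻¹ S` too.
    have h1 := hc η⁻¹ (phase η v) hζ.le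
    rw [rhoForm_smul_truncatedShift ρ _ hζ, hphase, hv0, mul_zero, ← smul_mul_assoc,
      ← mul_smul_comm, rhoForm_conj ρ n hU, rhoForm_smul_truncatedShift ρ _ hζ] at h1
    obtain ⟨e, he⟩ := hline _ (le_antisymm h1 (hpos _))
    refine ⟨e, ?_⟩
    ext i
    have h2 := congrArg (fun y => y i) he
    simp only [phase_apply, PiLp.smul_apply, smul_eq_mul] at h2 ⊢
    have h3 : η ^ (i : ℕ) * η⁻¹ ^ (i : ℕ) = 1 := by rw [← mul_pow, mul_inv_cancel₀ hη0, one_pow]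
    linear_combination η ^ (i : ℕ) * h2 - (U (phase η v)).ofLp i * h3
  have hcomm : S * (d • 1) = (d • 1) * S := by simp
  rw [mul_assoc, hcomm, ← mul_assoc, Unitary.star_mul_self_of_mem hU, one_mul]

end Orbit

end RhoHarnack

end

theorem corollary3p6 (ρ : ℝ) (hρ : 1 < ρ) (n : ℕ) (hn : Even (n + 1)) :
    RhoHarnack.unitaryOrbit (RhoHarnack.normalizedShift ρ (n + 1)) ∩
        RhoHarnack.harnackPart ρ (RhoHarnack.normalizedShift ρ (n + 1)) =
      {RhoHarnack.normalizedShift ρ (n + 1)} := by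
  have hodd : Odd n := by
    rcases Nat.even_or_odd n with h | h
    · exact absurd hn (Nat.not_even_iff_odd.2 h.add_one)
    · exact h
  obtain ⟨a, ha, hS, hpos, hnull⟩ :=
    RhoHarnack.exists_normalizedShift_eq (zero_lt_one.trans hρ) hodd.pos
  rw [hS]
  refine Set.Subset.antisymm ?_ ?_
  · rintro T ⟨⟨U, hU, rfl⟩, hT, -⟩
    exact RhoHarnack.eq_of_harnackDominated_conj hρ ha hodd hpos hnull hU hT
  · rintro T rfl
    have h := RhoHarnack.harnackDominated_refl
      (RhoHarnack.isRhoContraction_truncatedShift (zero_lt_one.trans hρ) a hpos)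
    exact ⟨⟨1, one_mem _, by simp⟩, h, h⟩
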